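/- **Theorem 6.2 (monotonicity theorem).** Let $x=(x_1,\dots,x_n)$ be the standard coordinates on $\mathbb R^n$ and $\xi=(\xi_1,\dots,\xi_n)$ a second copy of them. A superform of bidegree $(p,q)$ on an open set $U\subset\mathbb R^n$ is an expression $a=\sum_{|I|=p,|K|=q}a_{I,K}(x)\,dx_I\wedge d\xi_K$ with smooth coefficients depending on $x\in U$ only, where all the $dx_i,d\xi_k$ anticommute, and $da=\sum_k dx_k\wedge\partial a/\partial x_k$. Let $J$ be the algebra homomorphism, linear over functions, with $J(dx_i)=d\xi_i$ and $J(d\xi_i)=-dx_i$, write $\alpha^{\#}=J\alpha$ for $(1,0)$-forms $\alpha$, and put $\beta=\sum_i dx_i\wedge d\xi_i$. A supercurrent of bidimension $(p,q)$ on $U$ is a continuous linear functional $T$ on the space of superforms of bidegree $(p,q)$ with compact support in $U$ (with the usual test function topology); set $(T\wedge b).a=T.(b\wedge a)$ for constant forms $b$, and $dT.a=(-1)^{\deg a}\,T.da$. Let $m\ge 1$, let $U$ be an open neighbourhood of the origin in $\mathbb R^n$, and let $T$ be a minimal supercurrent of bidimension $(m,m)$ on $U$, i.e. $T$ is - symmetric: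 $T.(Ja)=T.a$ for all test forms $a$ of bidegree $(m,m)$; - (weakly) positive: $T.(\alpha_1\wedge\alpha_1^{\#}\wedge\dots\wedge\alpha_m\wedge\alpha_m^{\#})\ge 0$ for all smooth $(1,0)$-forms $\alpha_1,\dots,\alpha_m$ with compact support in $U$; - minimal: $dT\wedge\beta^{m-1}=0$ on $U$. Then $T\wedge\beta^m/m!$ is a positive Radon measure on $U$, and $$ r\longmapsto r^{-m}\int_{|x|<r}T\wedge\beta^m/m! $$ is nondecreasing on the set of all $r>0$ for which the ball $\{|x|<r\}$ is contained in $U$ (the value $+\infty$ being allowed if the closed ball is not contained in $U$). -/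

import Mathlib

open MeasureTheory TopologicalSpace
open scoped Distributions Nat

/-- The real algebra of constant superforms on `ℝⁿ`, i.e. the exterior algebra of
`T^*(E_s) = T^*(E_0) ⊕ T^*(E_1)`.  A covector is written as the pair of its coordinates in the bases
`dx_1, …, dx_n` and `dξ_1, …, dξ_n`; the product of the algebra is the wedge product. -/
abbrev SuperAlg (n : ℕ) : Type :=
  ExteriorAlgebra ℝ ((Fin n → ℝ) × (Fin n → ℝ))

namespace SuperAlg

instance instFinite (n : ℕ) : Module.Finite ℝ (SuperAlg n) := by
  let M := (Fin n → ℝ) × (Fin n → ℝ)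
  have htop : (⨆ k : ℕ, ⋀[ℝ]^k M) = ⊤ :=
    (DirectSum.Decomposition.isInternal (fun k : ℕ => ⋀[ℝ]^k M)).submodule_iSup_eq_top
  have hbot : ∀ k : ℕ, Module.finrank ℝ M < k → (⋀[ℝ]^k M) = ⊥ := by
    intro k hk
    rw [← Submodule.finrank_eq_zero (R := ℝ), exteriorPower.finrank_eq]
    exact Nat.choose_eq_zero_of_lt hk
  have hfin : (⨆ k : Fin (Module.finrank ℝ M + 1), ⋀[ℝ]^(k : ℕ) M) = ⊤ := by
    rw [eq_top_iff, ← htop]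
    refine iSup_le fun k => ?_
    by_cases hk : Module.finrank ℝ M < k
    · rw [hbot k hk]
      exact bot_le
    · exact le_iSup (fun j : Fin (Module.finrank ℝ M + 1) => ⋀[ℝ]^(j : ℕ) M)
        ⟨k, by omega⟩
  refine Module.finite_def.mpr ?_
  rw [← hfin]
  exact Submodule.fg_iSup _ fun k => Module.Finite.iff_fg.mp inferInstance

/-- The norm of the coordinates in some basis.  The algebra is finite dimensional, so every norm
gives the same topology and the same smooth maps. -/
noncomputable instance instNormedAddCommGroup (n : ℕ) : NormedAddCommGroup (SuperAlg n) :=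
  NormedAddCommGroup.induced (SuperAlg n) (Fin (Module.finrank ℝ (SuperAlg n)) → ℝ)
    (Module.finBasis ℝ (SuperAlg n)).equivFun.toLinearMap
    (Module.finBasis ℝ (SuperAlg n)).equivFun.injective

noncomputable instance instNormedSpace (n : ℕ) : NormedSpace ℝ (SuperAlg n) :=
  NormedSpace.induced ℝ (SuperAlg n) (Fin (Module.finrank ℝ (SuperAlg n)) → ℝ)
    (Module.finBasis ℝ (SuperAlg n)).equivFun.toLinearMap

variable {n : ℕ}

/-- The covector `∑ i, a i dx_i`. -/
noncomputable def ofX (n : ℕ) : (Fin n → ℝ) →ₗ[ℝ] SuperAlg n :=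
  ExteriorAlgebra.ι ℝ ∘ₗ LinearMap.inl ℝ (Fin n → ℝ) (Fin n → ℝ)

/-- The covector `∑ i, a i dξ_i`. -/
noncomputable def ofXi (n : ℕ) : (Fin n → ℝ) →ₗ[ℝ] SuperAlg n :=
  ExteriorAlgebra.ι ℝ ∘ₗ LinearMap.inr ℝ (Fin n → ℝ) (Fin n → ℝ)

noncomputable def dx (i : Fin n) : SuperAlg n := ofX n (Pi.single i 1)

noncomputable def dxi (i : Fin n) : SuperAlg n := ofXi n (Pi.single i 1)

/-- The span of the `dx_I ∧ dξ_J` with `|I| = p` and `|J| = q`. -/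
noncomputable def bidegree (n p q : ℕ) : Submodule ℝ (SuperAlg n) :=
  LinearMap.range (ofX n) ^ p * LinearMap.range (ofXi n) ^ q

/-- The complex structure: the algebra homomorphism with `J dx_i = dξ_i` and `J dξ_i = - dx_i`. -/
noncomputable def J (n : ℕ) : SuperAlg n →ₐ[ℝ] SuperAlg n :=
  ExteriorAlgebra.map
    ((-(LinearMap.snd ℝ (Fin n → ℝ) (Fin n → ℝ))).prod (LinearMap.fst ℝ (Fin n → ℝ) (Fin n → ℝ)))

/-- The Kähler form `β = ∑ dx_i ∧ dξ_i`. -/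
noncomputable def beta (n : ℕ) : SuperAlg n := ∑ i : Fin n, dx i * dxi i

/-- A linear endomorphism of the (finite-dimensional) algebra as a continuous linear map. -/
noncomputable def clm (L : SuperAlg n →ₗ[ℝ] SuperAlg n) : SuperAlg n →L[ℝ] SuperAlg n :=
  L.toContinuousLinearMap

end SuperAlg

/-- Smooth superforms on `ℝⁿ` with compact support in the open set `U` (of all bidegrees), with the
usual topology of test functions. -/
abbrev TestForm {n : ℕ} (U : Opens (EuclideanSpace ℝ (Fin n))) : Type :=
  𝓓(U, SuperAlg n)

namespace TestForm

variable {n : ℕ} {U : Opens (EuclideanSpace ℝ (Fin n))}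

/-- A linear endomorphism of the algebra applied pointwise, `(map L a)(x) = L (a x)`. -/
noncomputable def map (L : SuperAlg n →ₗ[ℝ] SuperAlg n) : TestForm U →L[ℝ] TestForm U :=
  TestFunction.postcompCLM (SuperAlg.clm L)

/-- Left wedge product with a constant form, `a ↦ b ∧ a`. -/
noncomputable def constWedge (b : SuperAlg n) : TestForm U →L[ℝ] TestForm U :=
  map (LinearMap.mulLeft ℝ b)

/-- The exterior derivative `da = ∑ k, dx_k ∧ ∂a/∂x_k`. -/
noncomputable def d : TestForm U →L[ℝ] TestForm U :=
  ∑ k : Fin n, (constWedge (SuperAlg.dx k)).comp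
    (TestFunction.lineDerivCLM ℝ (EuclideanSpace.single k (1 : ℝ)) : TestForm U →L[ℝ] TestForm U)

/-- The sign operator: multiplication by `(-1) ^ k` on forms of total degree `k`. -/
noncomputable def sign : TestForm U →L[ℝ] TestForm U :=
  map (CliffordAlgebra.involute (Q := (0 : QuadraticForm ℝ ((Fin n → ℝ) × (Fin n → ℝ))))).toLinearMap

/-- A test function seen as a superform of bidegree `(0, 0)`. -/
noncomputable def ofFun : 𝓓(U, ℝ) →L[ℝ] TestForm U :=
  TestFunction.postcompCLM (Algebra.linearMap ℝ (SuperAlg n)).toContinuousLinearMap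

end TestForm

/-- Supercurrents on `U`: continuous linear functionals on the space of test superforms;
`T a` is thought of as the superintegral of `T ∧ a`. -/
abbrev Supercurrent {n : ℕ} (U : Opens (EuclideanSpace ℝ (Fin n))) : Type :=
  TestForm U →L[ℝ] ℝ

namespace Supercurrent

variable {n : ℕ} {U : Opens (EuclideanSpace ℝ (Fin n))}

/-- `T` is a functional on forms of bidegree `(p, q)`, extended by zero to the other bidegrees. -/
def HasBidimension (p q : ℕ) (T : Supercurrent U) : Prop :=
  ∀ (p' q' : ℕ), (p', q') ≠ (p, q) →
    ∀ a : TestForm U, (∀ x, a x ∈ SuperAlg.bidegree n p' q') → T a = 0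

/-- `(T ∧ b).a = T.(b ∧ a)` for a constant form `b`. -/
noncomputable def wedge (T : Supercurrent U) (b : SuperAlg n) : Supercurrent U :=
  T.comp (TestForm.constWedge b)

/-- `dT.a = (-1) ^ deg a * T.(da)`.  If `T` has degree `k`, then `dT` is tested on forms with
`deg a = 2n - k - 1`, and the sign is the usual `(-1) ^ (k + 1)`. -/
noncomputable def d (T : Supercurrent U) : Supercurrent U :=
  T.comp (TestForm.d.comp TestForm.sign)

/-- `J`-invariance; for bidimension `(m, m)` it says that the coefficients satisfy
`T_{I,K} = T_{K,I}`. -/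
def IsSymmetric (T : Supercurrent U) : Prop :=
  ∀ a : TestForm U, T (TestForm.map (SuperAlg.J n).toLinearMap a) = T a

/-- Weak positivity: `T.(α_1 ∧ α_1^# ∧ … ∧ α_m ∧ α_m^#) ≥ 0` for all smooth `(1,0)`-forms `α_j` with
compact support in `U`, where `α^# = J α`.  The form `a` below is that product. -/
def IsPositive (m : ℕ) (T : Supercurrent U) : Prop :=
  ∀ (α : Fin m → 𝓓(U, Fin n → ℝ)) (a : TestForm U),
    (∀ x, a x = (List.ofFn fun j : Fin m =>
      SuperAlg.ofX n (α j x) * SuperAlg.J n (SuperAlg.ofX n (α j x))).prod) →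
    0 ≤ T a

/-- Minimal supercurrents of bidimension `(m, m)`, for `m ≥ 1`. -/
structure IsMinimal (m : ℕ) (T : Supercurrent U) : Prop where
  hasBidimension : T.HasBidimension m m
  isSymmetric : T.IsSymmetric
  isPositive : T.IsPositive m
  closed : T.d.wedge (SuperAlg.beta n ^ (m - 1)) = 0

/-- `μ` restricted to `U` is a Radon measure which represents the current `T ∧ β^m / m!`, i.e.
`∫ f dμ = (T ∧ β^m / m!).f` for every test function `f` on `U`. -/
def IsMassMeasure (m : ℕ) (T : Supercurrent U) (μ : Measure (EuclideanSpace ℝ (Fin n))) : Prop :=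
  (∀ K : Set (EuclideanSpace ℝ (Fin n)), IsCompact K → K ⊆ U → μ K < ⊤) ∧
  ∀ f : 𝓓(U, ℝ),
    T.wedge ((m ! : ℝ)⁻¹ • SuperAlg.beta n ^ m) (TestForm.ofFun f) = ∫ x, f x ∂μ

end Supercurrent

/-! Let α = ∑ x_i dx_i and let μ be the mass measure. Minimality, tested on u ∑ x_k dξ_k with u =
h(|x|²), is a first variation formula: `T` annihilates u β^m + 2h'(|x|²) β^(m-1) ∧ α ∧ α^#, for du =
2h'(|x|²) α (`radial_identity`).

The second term is controlled by positivity. By Lagrange's identity |x|² β - α ∧ α^# is a sum of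
forms γ ∧ γ^#, so `T` is nonnegative on its m-th power. Since α ∧ α^# is central with square zero,
this power is |x|^(2(m-1)) (|x|² β^m - m β^(m-1) ∧ α ∧ α^#). For nonincreasing h, constant near 0,
the factor |x|^(2(m-1)) can be divided out, and m ∫ h dμ ≤ ∫ -2h'(|x|²)|x|² dμ follows
(`radial_inequality`).

For h(t) = χ(t/r²) and F(r) = ∫ χ(|x|²/r²) dμ this says m F ≤ r F', so F/r^m is nondecreasing
(`monotoneOn_smoothed_mass`). Letting χ approach the indicator of [0,1) gives the balls. -/

open scoped ContDiff

/-- The ordered products on the right are exactly the shape tested by `IsPositive`. -/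
theorem sum_pow_eq_sum_prod_ofFn {R ι : Type*} [Semiring R] [Fintype ι] (y : ι → R) (m : ℕ) :
    (∑ i, y i) ^ m = ∑ c : Fin m → ι, (List.ofFn fun j => y (c j)).prod := by
  induction m with
  | zero => simp
  | succ m ih =>
    rw [pow_succ', ih, Finset.sum_mul_sum, ← Fintype.sum_prod_type',
      ← (Fin.consEquiv fun _ : Fin (m + 1) => ι).sum_comp]
    refine Finset.sum_congr rfl fun p _ => ?_
    simp [List.ofFn_succ, Fin.consEquiv]

/-- In the binomial expansion only the terms of degree at most one in `s` survive. -/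
theorem Commute.sub_pow_succ_of_mul_self_eq_zero {R : Type*} [Ring R] {y s : R} (h : Commute y s)
    (hs : s * s = 0) (k : ℕ) :
    (y - s) ^ (k + 1) = y ^ (k + 1) - (k + 1) • (y ^ k * s) := by
  induction k with
  | zero => simp
  | succ k ih =>
    have h1 : y ^ k * s * y = y ^ (k + 1) * s := by
      rw [mul_assoc, ← h.eq, ← mul_assoc, pow_succ]
    have h2 : y ^ k * s * s = 0 := by rw [mul_assoc, hs, mul_zero]
    rw [pow_succ, ih, sub_mul, mul_sub, mul_sub, ← pow_succ, smul_mul_assoc, smul_mul_assoc, h1, h2,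
      add_smul (k + 1) 1, one_smul]
    simp only [smul_zero, sub_zero]
    abel

/-! ### Algebra of constant superforms -/

namespace SuperAlg

variable {n : ℕ}

theorem J_ofX (v : Fin n → ℝ) : J n (ofX n v) = ofXi n v := by
  simp [J, ofX, ofXi]

/-- The form `α ∧ α^#` of the constant `(1,0)`-form `α = ∑ i, v i dx_i`. -/
noncomputable def wedgeSharp (v : Fin n → ℝ) : SuperAlg n := ofX n v * ofXi n v

/-- Moving a covector past a product of two covectors changes the sign twice, so such products are
central. -/
theorem commute_mul_ι (a b : (Fin n → ℝ) × (Fin n → ℝ)) (z : SuperAlg n) :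
    Commute (ExteriorAlgebra.ι ℝ a * ExteriorAlgebra.ι ℝ b) z := by
  have hswap : ∀ u v : (Fin n → ℝ) × (Fin n → ℝ), ExteriorAlgebra.ι ℝ u * ExteriorAlgebra.ι ℝ v =
      -(ExteriorAlgebra.ι ℝ v * ExteriorAlgebra.ι ℝ u) := fun u v =>
    eq_neg_of_add_eq_zero_left (ExteriorAlgebra.ι_add_mul_swap u v)
  induction z using ExteriorAlgebra.induction with
  | algebraMap r => exact Algebra.commutes' r _ |>.symm
  | ι c =>
    rw [commute_iff_eq, mul_assoc, hswap b c, mul_neg, ← mul_assoc, hswap a c, neg_mul, neg_neg,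
      mul_assoc]
  | mul a b ha hb => exact ha.mul_right hb
  | add a b ha hb => exact ha.add_right hb

theorem commute_wedgeSharp (v : Fin n → ℝ) (z : SuperAlg n) : Commute (wedgeSharp v) z :=
  commute_mul_ι _ _ z

theorem beta_eq_sum_wedgeSharp : beta n = ∑ i, wedgeSharp (Pi.single i 1) := rfl

theorem commute_beta (z : SuperAlg n) : Commute (beta n) z := by
  rw [beta_eq_sum_wedgeSharp]
  exact Commute.sum_left _ _ _ fun i _ => commute_wedgeSharp _ z

theorem wedgeSharp_mul_self (v : Fin n → ℝ) : wedgeSharp v * wedgeSharp v = 0 := by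
  have h : ofXi n v * ofXi n v = 0 := ExteriorAlgebra.ι_sq_zero _
  calc wedgeSharp v * wedgeSharp v = wedgeSharp v * ofX n v * ofXi n v := by
        rw [mul_assoc]; rfl
    _ = ofX n v * (ofX n v * (ofXi n v * ofXi n v)) := by
        rw [(commute_wedgeSharp v (ofX n v)).eq, wedgeSharp]; simp only [mul_assoc]
    _ = 0 := by simp [h]

theorem ofX_eq_sum (v : Fin n → ℝ) : ofX n v = ∑ i, v i • dx i := by
  conv_lhs => rw [pi_eq_sum_univ' v]
  simp only [map_sum, map_smul]
  refine Finset.sum_congr rfl fun i _ => ?_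
  congr 2

theorem ofXi_eq_sum (v : Fin n → ℝ) : ofXi n v = ∑ i, v i • dxi i := by
  conv_lhs => rw [pi_eq_sum_univ' v]
  simp only [map_sum, map_smul]
  refine Finset.sum_congr rfl fun i _ => ?_
  congr 2

theorem wedgeSharp_eq_sum (v : Fin n → ℝ) :
    wedgeSharp v = ∑ i, ∑ j, (v i * v j) • (dx i * dxi j) := by
  simp only [wedgeSharp, ofX_eq_sum, ofXi_eq_sum, Finset.sum_mul_sum, smul_mul_smul_comm]

/-- Lagrange's identity for the form `|v|² β - α ∧ α^#`. -/
theorem sum_wedgeSharp_lagrange (v : Fin n → ℝ) :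
    ∑ p : Fin n × Fin n, wedgeSharp (v p.1 • Pi.single p.2 (1 : ℝ) - v p.2 • Pi.single p.1 1) =
      (2 : ℝ) • ((∑ i, v i ^ 2) • beta n - wedgeSharp v) := by
  -- After summation each square term gives |v|² β and each mixed term gives α ∧ α^#. Every pair {i,
  -- j} occurs in both orders, whence the factor 2.
  have h : ∀ i j : Fin n, wedgeSharp (v i • Pi.single j (1 : ℝ) - v j • Pi.single i 1) =
      (v i ^ 2) • (dx j * dxi j) - (v j * v i) • (dx j * dxi i) - (v i * v j) • (dx i * dxi j)
        + (v j ^ 2) • (dx i * dxi i) := by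
    intro i j
    simp only [wedgeSharp, map_sub, map_smul]
    change (v i • dx j - v j • dx i) * (v i • dxi j - v j • dxi i) = _
    simp only [sub_mul, mul_sub, smul_mul_smul_comm, ← pow_two]
    rw [mul_comm (v j) (v i)]
    abel
  rw [Fintype.sum_prod_type]
  simp only [h, Finset.sum_add_distrib, Finset.sum_sub_distrib]
  rw [Finset.sum_comm (f := fun i j => (v j * v i) • (dx j * dxi i)), ← wedgeSharp_eq_sum,
    Finset.sum_comm (f := fun i j => (v j ^ 2) • (dx i * dxi i))]
  simp only [← Finset.smul_sum, ← Finset.sum_smul]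
  change (∑ i, v i ^ 2) • beta n - _ - _ + (∑ i, v i ^ 2) • beta n = _
  rw [smul_sub, two_smul, two_smul]
  abel

/-- The linear expansion applies because α ∧ α^# is central with square zero. The common factor `N ^
k` is what has to be divided out when `N` = |x|². -/
theorem smul_beta_sub_wedgeSharp_pow (v : Fin n → ℝ) (N : ℝ) (k : ℕ) :
    (N • beta n - wedgeSharp v) ^ (k + 1) =
      N ^ k • (N • beta n ^ (k + 1) - ((k : ℝ) + 1) • (beta n ^ k * wedgeSharp v)) := by
  rw [((commute_wedgeSharp v (N • beta n)).symm).sub_pow_succ_of_mul_self_eq_zero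
    (wedgeSharp_mul_self v), smul_pow, smul_pow, smul_sub, smul_smul, ← pow_succ, smul_mul_assoc,
    ← Nat.cast_smul_eq_nsmul ℝ, smul_comm]
  push_cast
  rfl

theorem involute_ofX (v : Fin n → ℝ) :
    CliffordAlgebra.involute (Q := (0 : QuadraticForm ℝ ((Fin n → ℝ) × (Fin n → ℝ)))) (ofX n v) =
      -ofX n v :=
  CliffordAlgebra.involute_ι _

theorem involute_ofXi (v : Fin n → ℝ) :
    CliffordAlgebra.involute (Q := (0 : QuadraticForm ℝ ((Fin n → ℝ) × (Fin n → ℝ)))) (ofXi n v) =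
      -ofXi n v :=
  CliffordAlgebra.involute_ι _

theorem involute_beta :
    CliffordAlgebra.involute (Q := (0 : QuadraticForm ℝ ((Fin n → ℝ) × (Fin n → ℝ)))) (beta n) =
      beta n := by
  rw [beta, map_sum]
  refine Finset.sum_congr rfl fun i _ => ?_
  rw [map_mul, dx, dxi, involute_ofX, involute_ofXi, neg_mul_neg]

variable {E : Type*} [NormedAddCommGroup E] [NormedSpace ℝ E]

theorem contDiff_mul {k : ℕ∞ω} {f g : E → SuperAlg n} (hf : ContDiff ℝ k f)
    (hg : ContDiff ℝ k g) : ContDiff ℝ k fun x => f x * g x := by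
  let B : SuperAlg n →L[ℝ] SuperAlg n →L[ℝ] SuperAlg n :=
    (LinearMap.toContinuousLinearMap.toLinearMap ∘ₗ LinearMap.mul ℝ (SuperAlg n)).toContinuousLinearMap
  exact (B.contDiff.comp hf).clm_apply hg

theorem contDiff_pow {k : ℕ∞ω} {f : E → SuperAlg n} (hf : ContDiff ℝ k f) (m : ℕ) :
    ContDiff ℝ k fun x => f x ^ m := by
  induction m with
  | zero => simpa using contDiff_const
  | succ m ih => simpa only [pow_succ] using contDiff_mul ih hf

theorem contDiff_list_prod {k : ℕ∞ω} {m : ℕ} {f : Fin m → E → SuperAlg n}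
    (hf : ∀ j, ContDiff ℝ k (f j)) : ContDiff ℝ k fun x => (List.ofFn fun j => f j x).prod := by
  induction m with
  | zero => simpa using contDiff_const
  | succ m ih =>
    simpa only [List.ofFn_succ, List.prod_cons] using
      contDiff_mul (hf 0) (ih fun j => hf j.succ)

theorem contDiff_wedgeSharp {k : ℕ∞ω} {f : E → Fin n → ℝ} (hf : ContDiff ℝ k f) :
    ContDiff ℝ k fun x => wedgeSharp (f x) :=
  contDiff_mul ((ofX n).toContinuousLinearMap.contDiff.comp hf)
    ((ofXi n).toContinuousLinearMap.contDiff.comp hf)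

theorem wedgeSharp_smul (c : ℝ) (v : Fin n → ℝ) : wedgeSharp (c • v) = c ^ 2 • wedgeSharp v := by
  simp only [wedgeSharp, map_smul, smul_mul_smul_comm, pow_two]

end SuperAlg

/-! ### Test functions with prescribed support -/

namespace TestFunction

variable {E : Type*} [NormedAddCommGroup E] [NormedSpace ℝ E] {U : Opens E}
  {F : Type*} [NormedAddCommGroup F] [NormedSpace ℝ F]

/-- A smooth function dominated in support by a test function is a test function. -/
noncomputable def ofSupport {F' : Type*} [NormedAddCommGroup F'] [NormedSpace ℝ F'] (f : 𝓓(U, F')) (G : E → F)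
    (hG : ContDiff ℝ ∞ G) (h : ∀ x, f x = 0 → G x = 0) : 𝓓(U, F) :=
  have hs : tsupport G ⊆ tsupport f :=
    closure_mono fun x hx => by
      contrapose! hx
      simpa using h x (by simpa using hx)
  { toFun := G
    contDiff' := hG
    hasCompactSupport' := f.hasCompactSupport.of_isClosed_subset (isClosed_tsupport _) hs
    tsupport_subset' := hs.trans f.tsupport_subset }

@[simp]
theorem ofSupport_apply {F' : Type*} [NormedAddCommGroup F'] [NormedSpace ℝ F'] (f : 𝓓(U, F'))
    (G : E → F) (hG : ContDiff ℝ ∞ G) (h : ∀ x, f x = 0 → G x = 0) (x : E) :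
    ofSupport f G hG h x = G x := rfl

/-- The product of a scalar test function and a smooth function. -/
noncomputable def smulSmooth (f : 𝓓(U, ℝ)) (G : E → F) (hG : ContDiff ℝ ∞ G) : 𝓓(U, F) :=
  ofSupport f (fun x => f x • G x) (f.contDiff.smul hG) fun x hx => by simp [hx]

@[simp]
theorem smulSmooth_apply (f : 𝓓(U, ℝ)) (G : E → F) (hG : ContDiff ℝ ∞ G) (x : E) :
    smulSmooth f G hG x = f x • G x := rfl

theorem exists_cutoff [FiniteDimensional ℝ E] {K : Set E} (hK : IsCompact K) (hKU : K ⊆ U) :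
    ∃ η : 𝓓(U, ℝ), (∀ x, 0 ≤ η x) ∧ ∀ x ∈ K, η x = 1 := by
  obtain ⟨L, hL, hKL, hLU⟩ := exists_compact_between hK U.isOpen hKU
  obtain ⟨f, hf, hr, hsupp, h1⟩ := exists_contMDiff_support_eq_eq_one_iff (modelWithCornersSelf ℝ E)
    (n := ⊤) isOpen_interior hK.isClosed hKL
  have hs : tsupport f ⊆ L := by
    rw [tsupport, hsupp]
    exact closure_minimal interior_subset hL.isClosed
  refine ⟨⟨f, hf.contDiff, hL.of_isClosed_subset (isClosed_tsupport _) hs, hs.trans hLU⟩,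
    fun x => ?_, fun x hx => (h1 x).1 hx⟩
  exact (hr (Set.mem_range_self x)).1

end TestFunction

/-! ### Positivity on m-th powers of sums of α ∧ α^# -/

namespace Supercurrent

open SuperAlg TestFunction

variable {n m : ℕ} {U : Opens (EuclideanSpace ℝ (Fin n))} {T : Supercurrent U}

theorem IsPositive.nonneg_of_eq_sum_pow (hT : T.IsPositive m) (hm : 1 ≤ m) {ι : Type*} [Fintype ι]
    (A : ι → 𝓓(U, Fin n → ℝ)) (a : TestForm U)
    (ha : ∀ x, a x = (∑ c, wedgeSharp (A c x)) ^ m) : 0 ≤ T a := by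
  obtain ⟨k, rfl⟩ : ∃ k, m = k + 1 := ⟨m - 1, by omega⟩
  -- The first factor bounds the support of the product, so the product must be nonempty.
  let P : (Fin (k + 1) → ι) → TestForm U := fun c =>
    ofSupport (A (c 0)) (fun x => (List.ofFn fun j => wedgeSharp (A (c j) x)).prod)
      (contDiff_list_prod fun j => contDiff_wedgeSharp (A (c j)).contDiff)
      (fun x hx => by simp [List.ofFn_succ, hx, wedgeSharp])
  have hP : a = ∑ c, P c := by
    ext x
    rw [ha, sum_pow_eq_sum_prod_ofFn]
    simp [P]
  rw [hP, map_sum]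
  refine Finset.sum_nonneg fun c _ => hT (fun j => A (c j)) _ fun x => ?_
  simp only [P, ofSupport_apply, J_ofX, wedgeSharp]

/-- The coefficient is absorbed into the covectors as a 2m-th root, each α ∧ α^# being quadratic in
α. The root may fail to be smooth at zeros of `f`, so `f + ε` is used, cut off by `η`, and ε is then
made small. -/
theorem IsPositive.nonneg_of_eq_smul_sum_pow (hT : T.IsPositive m) (hm : 1 ≤ m) {ι : Type*}
    [Fintype ι] (f : 𝓓(U, ℝ)) (hf : ∀ x, 0 ≤ f x) (A : ι → EuclideanSpace ℝ (Fin n) → Fin n → ℝ)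
    (hA : ∀ c, ContDiff ℝ ∞ (A c)) (a : TestForm U)
    (ha : ∀ x, a x = f x • (∑ c, wedgeSharp (A c x)) ^ m) : 0 ≤ T a := by
  obtain ⟨η, -, hη1⟩ := exists_cutoff f.hasCompactSupport f.tsupport_subset
  have hω : ContDiff ℝ ∞ fun x => (∑ c, wedgeSharp (A c x)) ^ m :=
    contDiff_pow (ContDiff.sum fun c _ => contDiff_wedgeSharp (hA c)) m
  let b : TestForm U := ofSupport η (fun x => η x ^ (2 * m) • (∑ c, wedgeSharp (A c x)) ^ m)
    ((η.contDiff.pow _).smul hω) (fun x hx => by rw [hx, zero_pow (by omega), zero_smul])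
  have key : ∀ ε : ℝ, 0 < ε → 0 ≤ T a + ε * T b := by
    intro ε hε
    have hpos : ∀ x, 0 < f x + ε := fun x => add_pos_of_nonneg_of_pos (hf x) hε
    let w : EuclideanSpace ℝ (Fin n) → ℝ := fun x => (f x + ε) ^ (((2 * m : ℕ) : ℝ)⁻¹)
    have hw : ContDiff ℝ ∞ w :=
      (f.contDiff.add contDiff_const).rpow_const_of_ne fun x => (hpos x).ne'
    have hwm : ∀ x, w x ^ (2 * m) = f x + ε := fun x =>
      Real.rpow_inv_natCast_pow (hpos x).le (by omega)
    have := hT.nonneg_of_eq_sum_pow hm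
      (fun c => smulSmooth η (fun x => w x • A c x) (hw.smul (hA c))) (a + ε • b) (fun x => by
        have hfη : η x ^ (2 * m) * f x = f x := by
          by_cases hx : f x = 0
          · simp [hx]
          · rw [hη1 x (subset_tsupport _ hx), one_pow, one_mul]
        simp only [smulSmooth_apply, wedgeSharp_smul, ← Finset.smul_sum, smul_pow, ← pow_mul,
          smul_smul]
        change a x + ε • (η x ^ (2 * m) • _) = _
        rw [ha, smul_smul, ← add_smul, mul_pow, hwm, mul_add, hfη, mul_comm ε])
    simpa using this
  by_contra! hneg
  have hb : 0 < 2 * (|T b| + 1) := by positivity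
  -- With this ε the error ε `T b` is at most -`T a`/2, so the sum in `key` would be negative.
  have h1 := key (-T a / (2 * (|T b| + 1))) (div_pos (neg_pos.2 hneg) hb)
  have h2 : -T a / (2 * (|T b| + 1)) * T b ≤ -T a / (2 * (|T b| + 1)) * (|T b| + 1) :=
    mul_le_mul_of_nonneg_left ((le_abs_self _).trans (by linarith))
      (div_pos (neg_pos.2 hneg) hb).le
  have h3 : -T a / (2 * (|T b| + 1)) * (|T b| + 1) = -T a / 2 := by
    field_simp
  linarith

end Supercurrent

/-! ### Positive distributions are Radon measures -/

namespace TestFunction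

open scoped CompactlySupported

variable {E : Type*} [NormedAddCommGroup E] [NormedSpace ℝ E] {U : Opens E}

/-- A test function on `U` as a compactly supported continuous function on the subtype `U`. -/
noncomputable def toCompactlySupported : 𝓓(U, ℝ) →ₗ[ℝ] C_c(U, ℝ) where
  toFun f :=
    { toFun := fun x => f x
      continuous_toFun := f.continuous.comp continuous_subtype_val
      hasCompactSupport' := by
        refine HasCompactSupport.intro (K := Subtype.val ⁻¹' tsupport f)
          (Topology.IsInducing.subtypeVal.isCompact_preimage_iff ?_ |>.2 f.hasCompactSupport)
          fun x hx => image_eq_zero_of_notMem_tsupport hx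
        simpa using f.tsupport_subset }
  map_add' f g := rfl
  map_smul' c f := rfl

@[simp]
theorem toCompactlySupported_apply (f : 𝓓(U, ℝ)) (x : U) : toCompactlySupported f x = f x := rfl

theorem toCompactlySupported_injective :
    Function.Injective (toCompactlySupported : 𝓓(U, ℝ) →ₗ[ℝ] C_c(U, ℝ)) := by
  intro f g h
  ext x
  by_cases hx : x ∈ U
  · exact DFunLike.congr_fun h (⟨x, hx⟩ : U)
  · rw [image_eq_zero_of_notMem_tsupport fun h => hx (f.tsupport_subset h),
      image_eq_zero_of_notMem_tsupport fun h => hx (g.tsupport_subset h)]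

/-- A positive distribution is a Radon measure. -/
theorem exists_measure_of_nonneg [FiniteDimensional ℝ E] [MeasurableSpace E] [BorelSpace E]
    (Λ : 𝓓(U, ℝ) →ₗ[ℝ] ℝ) (hΛ : ∀ f : 𝓓(U, ℝ), (∀ x, 0 ≤ f x) → 0 ≤ Λ f) :
    ∃ μ : Measure E, (∀ K, IsCompact K → K ⊆ U → μ K < ⊤) ∧ ∀ f : 𝓓(U, ℝ), Λ f = ∫ x, f x ∂μ := by
  have : LocallyCompactSpace U := U.isOpen.locallyCompactSpace
  let e := LinearEquiv.ofInjective _ (toCompactlySupported_injective (U := U))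
  let L : C_c(U, ℝ) →ₗ.[ℝ] ℝ := ⟨LinearMap.range toCompactlySupported, Λ ∘ₗ e.symm.toLinearMap⟩
  have hL : ∀ f : 𝓓(U, ℝ), L (e f) = Λ f := fun f => by
    change Λ (e.symm (e f)) = Λ f
    rw [e.symm_apply_apply]
  let s : PointedCone ℝ C_c(U, ℝ) :=
    { carrier := {f | ∀ x, 0 ≤ f x}
      add_mem' := fun ha hb x => add_nonneg (ha x) (hb x)
      zero_mem' := fun _ => le_rfl
      smul_mem' := fun c _ hf x => mul_nonneg c.2 (hf x) }
  -- M. Riesz extension from test functions to all of C_c(U) preserves positivity, so no density or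
  -- continuity argument is needed before Riesz–Markov–Kakutani.
  obtain ⟨g, hgL, hg0⟩ := riesz_extension s L
    (by
      intro x hx
      obtain ⟨f, rfl⟩ := e.surjective x
      rw [hL]
      refine hΛ f fun y => ?_
      by_cases hy : y ∈ U
      · exact hx (⟨y, hy⟩ : U)
      · rw [image_eq_zero_of_notMem_tsupport fun h => hy (f.tsupport_subset h)])
    (by
      intro y
      -- Every `y` is moved into the cone by a test function: `C • η` with `η = 1` on the support of
      -- `y` and `C` a bound for |y|.
      obtain ⟨η, hη0, hη1⟩ := exists_cutoff (U := U) (y.hasCompactSupport.image continuous_subtype_val)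
        (by rintro _ ⟨x, -, rfl⟩; exact x.2)
      obtain ⟨C, hC⟩ := y.continuous.bounded_above_of_compact_support y.hasCompactSupport
      refine ⟨e (C • η), fun x => ?_⟩
      change 0 ≤ C * η x + y x
      by_cases hx : y x = 0
      · rw [hx, add_zero]
        exact mul_nonneg ((norm_nonneg _).trans (hC x)) (hη0 x)
      · rw [hη1 x ⟨x, subset_tsupport _ hx, rfl⟩, mul_one]
        have : -C ≤ y x := (abs_le.1 (hC x)).1
        linarith)
  let G : C_c(U, ℝ) →ₚ[ℝ] ℝ := PositiveLinearMap.mk₀ g hg0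
  have hemb : MeasurableEmbedding (Subtype.val : U → E) :=
    MeasurableEmbedding.subtype_coe U.isOpen.measurableSet
  refine ⟨(RealRMK.rieszMeasure G).map Subtype.val, fun K hK hKU => ?_, fun f => ?_⟩
  · rw [hemb.map_apply]
    exact (Topology.IsInducing.subtypeVal.isCompact_preimage_iff (by simpa using hKU)
      |>.2 hK).measure_lt_top
  · rw [hemb.integral_map]
    exact ((RealRMK.integral_rieszMeasure G (toCompactlySupported f)).trans
      ((hgL (e f)).trans (hL f))).symm

end TestFunction

/-! ### The mass measure and the first variation formula -/

namespace Supercurrent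

open SuperAlg TestFunction

variable {n m : ℕ} {U : Opens (EuclideanSpace ℝ (Fin n))} {T : Supercurrent U}

/-- Positivity applies to f β^m because β is the sum of the forms dx_i ∧ dξ_i = dx_i ∧ dx_i^#. -/
theorem IsMinimal.exists_isMassMeasure (hT : T.IsMinimal m) (hm : 1 ≤ m) :
    ∃ μ : Measure (EuclideanSpace ℝ (Fin n)), T.IsMassMeasure m μ := by
  refine exists_measure_of_nonneg
    ((T.wedge ((m ! : ℝ)⁻¹ • SuperAlg.beta n ^ m)).comp TestForm.ofFun).toLinearMap fun f hf => ?_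
  refine hT.isPositive.nonneg_of_eq_smul_sum_pow hm ((m ! : ℝ)⁻¹ • f)
    (fun x => mul_nonneg (by positivity) (hf x)) (fun i : Fin n => fun _ => Pi.single i 1)
    (fun i => contDiff_const) _ fun x => ?_
  change ((m ! : ℝ)⁻¹ • SuperAlg.beta n ^ m) * algebraMap ℝ (SuperAlg n) (f x) =
    ((m ! : ℝ)⁻¹ * f x) • _
  rw [← beta_eq_sum_wedgeSharp, ← Algebra.commutes, ← Algebra.smul_def, smul_smul, mul_comm]

/-- The current is tested on the form `∑ k, u x_k dξ_k`. -/
theorem IsMinimal.radial_identity (hT : T.IsMinimal m) (u ψ : 𝓓(U, ℝ))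
    (hu : ∀ x, HasFDerivAt u (ψ x • innerSL ℝ x) x) (a : TestForm U)
    (ha : ∀ x, a x = u x • beta n ^ (m - 1 + 1) + ψ x • (beta n ^ (m - 1) * wedgeSharp x.ofLp)) :
    T a = 0 := by
  let v : EuclideanSpace ℝ (Fin n) →L[ℝ] SuperAlg n :=
    ((ofXi n) ∘ₗ (WithLp.linearEquiv 2 ℝ (Fin n → ℝ)).toLinearMap).toContinuousLinearMap
  let b : TestForm U := smulSmooth u v v.contDiff
  have hb : T.d.wedge (beta n ^ (m - 1)) b = 0 := by rw [hT.closed]; rfl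
  let M : EuclideanSpace ℝ (Fin n) →L[ℝ] SuperAlg n :=
    (clm (CliffordAlgebra.involute
      (Q := (0 : QuadraticForm ℝ ((Fin n → ℝ) × (Fin n → ℝ))))).toLinearMap).comp
      ((clm (LinearMap.mulLeft ℝ (beta n ^ (m - 1)))).comp v)
  -- β is even and dξ_k is odd, so the sign operator contributes exactly one minus.
  have hM : ∀ x, M x = -(beta n ^ (m - 1) * ofXi n x.ofLp) := by
    intro x
    change CliffordAlgebra.involute (beta n ^ (m - 1) * ofXi n x.ofLp) = _
    rw [map_mul, map_pow, involute_beta, involute_ofXi, mul_neg]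
  let c : TestForm U := TestForm.sign (TestForm.constWedge (beta n ^ (m - 1)) b)
  have hc : ∀ x, c x = u x • M x := by
    intro x
    change clm _ (clm _ (u x • v x)) = _
    rw [map_smul, map_smul]
    rfl
  have hder : ∀ x w, lineDeriv ℝ c x w = u x • M w + (ψ x * inner ℝ x w) • M x := by
    intro x w
    have h1 : HasFDerivAt c (u x • M + (ψ x • innerSL ℝ x).smulRight (M x)) x := by
      rw [show (c : EuclideanSpace ℝ (Fin n) → SuperAlg n) = fun x => u x • M x from funext hc]
      exact (hu x).smul M.hasFDerivAt
    rw [(h1.hasLineDerivAt w).lineDeriv]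
    simp
  have hd : -a = TestForm.d c := by
    ext x
    -- Differentiating the coordinate x_k gives dx_k ∧ dξ_k, which sums to β. Differentiating `u`
    -- gives x_k dx_k, which sums to α.
    have hterm : ∀ k : Fin n, dx k * lineDeriv ℝ c x (EuclideanSpace.single k 1) =
        -(u x • (beta n ^ (m - 1) * (dx k * dxi k)) +
          ψ x • (beta n ^ (m - 1) * ((x k • dx k) * ofXi n x.ofLp))) := by
      intro k
      have hcomm : ∀ z, dx k * (beta n ^ (m - 1) * z) = beta n ^ (m - 1) * (dx k * z) := by
        intro z
        rw [← mul_assoc, ← mul_assoc, ((commute_beta (dx k)).pow_left _).eq]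
      rw [hder, hM, hM]
      simp only [mul_add, mul_neg, smul_neg, mul_smul_comm, smul_mul_assoc, hcomm, neg_add]
      rw [EuclideanSpace.inner_single_right, smul_smul]
      simp [dxi]
    have hsum : TestForm.d c x = ∑ k : Fin n, dx k * lineDeriv ℝ c x (EuclideanSpace.single k 1) := by
      simp only [TestForm.d, sum_apply]
      refine Finset.sum_congr rfl fun k _ => ?_
      change dx k * (TestFunction.lineDerivCLM ℝ (EuclideanSpace.single k (1 : ℝ)) c : TestForm U) x = _
      rw [TestFunction.lineDerivCLM_apply_of_le le_top]
    rw [hsum]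
    simp only [hterm, Finset.sum_neg_distrib, Finset.sum_add_distrib, ← Finset.smul_sum,
      ← Finset.mul_sum, ← Finset.sum_mul]
    change -a x = _
    rw [ha, pow_succ, wedgeSharp, ofX_eq_sum]
    rfl
  have : T (-a) = 0 := by rw [hd]; exact hb
  simpa using this

/-- A mass measure computes `T` on the multiples of `β ^ m`. -/
theorem IsMassMeasure.apply_eq {μ : Measure (EuclideanSpace ℝ (Fin n))} (hμ : T.IsMassMeasure m μ)
    (f : 𝓓(U, ℝ)) (a : TestForm U) (ha : ∀ x, a x = f x • beta n ^ m) :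
    T a = (m ! : ℝ) * ∫ x, f x ∂μ := by
  have h : a = (m ! : ℝ) • TestForm.constWedge ((m ! : ℝ)⁻¹ • beta n ^ m) (TestForm.ofFun f) := by
    ext x
    change a x = (m ! : ℝ) • ((m ! : ℝ)⁻¹ • beta n ^ m * algebraMap ℝ (SuperAlg n) (f x))
    rw [ha, ← Algebra.commutes, ← Algebra.smul_def, smul_comm (f x), smul_smul,
      mul_inv_cancel₀ (by positivity), one_smul]
  rw [← hμ.2 f, h, map_smul]
  rfl

end Supercurrent

/-! ### Radial test functions -/

namespace TestFunction

variable {n : ℕ} {U : Opens (EuclideanSpace ℝ (Fin n))}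

/-- The radial test function `x ↦ h (|x|²)`. -/
noncomputable def radial (h : ℝ → ℝ) (hh : ContDiff ℝ ∞ h) (ρ : ℝ)
    (hρ : Metric.closedBall (0 : EuclideanSpace ℝ (Fin n)) ρ ⊆ U)
    (h0 : ∀ x : EuclideanSpace ℝ (Fin n), ρ < ‖x‖ → h (‖x‖ ^ 2) = 0) : 𝓓(U, ℝ) :=
  have hs : tsupport (fun x : EuclideanSpace ℝ (Fin n) => h (‖x‖ ^ 2)) ⊆ Metric.closedBall 0 ρ :=
    closure_minimal (fun x hx => by
      contrapose! hx
      simpa using h0 x (by simpa using hx)) Metric.isClosed_closedBall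
  { toFun := fun x => h (‖x‖ ^ 2)
    contDiff' := hh.comp (contDiff_norm_sq ℝ)
    hasCompactSupport' := (isCompact_closedBall 0 ρ).of_isClosed_subset (isClosed_tsupport _) hs
    tsupport_subset' := hs.trans hρ }

@[simp]
theorem radial_apply (h : ℝ → ℝ) (hh : ContDiff ℝ ∞ h) (ρ : ℝ)
    (hρ : Metric.closedBall (0 : EuclideanSpace ℝ (Fin n)) ρ ⊆ U)
    (h0 : ∀ x : EuclideanSpace ℝ (Fin n), ρ < ‖x‖ → h (‖x‖ ^ 2) = 0)
    (x : EuclideanSpace ℝ (Fin n)) : radial h hh ρ hρ h0 x = h (‖x‖ ^ 2) := rfl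

end TestFunction

/-! ### The radial differential inequality -/

namespace Supercurrent

open SuperAlg TestFunction

variable {n m : ℕ} {U : Opens (EuclideanSpace ℝ (Fin n))} {T : Supercurrent U}

/-- The comparison `T ∧ β^(m-1) ∧ α ∧ α^# / (m-1)! ≤ |x|² T ∧ β^m / m!`, with `α = ∑ x_i dx_i`, inserted
into the first variation formula. -/
theorem IsMinimal.radial_inequality (hT : T.IsMinimal m) (hm : 1 ≤ m)
    {μ : Measure (EuclideanSpace ℝ (Fin n))} (hμ : T.IsMassMeasure m μ) {h : ℝ → ℝ}
    (hh : ContDiff ℝ ∞ h) (hanti : Antitone h) {ρ δ : ℝ} (hρ0 : 0 ≤ ρ) (hδ : 0 < δ)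
    (hconst : ∀ t < δ, h t = h 0) (hzero : ∀ t, ρ ^ 2 < t → h t = 0)
    (hρ : Metric.closedBall (0 : EuclideanSpace ℝ (Fin n)) ρ ⊆ U) :
    (m : ℝ) * ∫ x, h (‖x‖ ^ 2) ∂μ ≤ ∫ x, -2 * deriv h (‖x‖ ^ 2) * ‖x‖ ^ 2 ∂μ := by
  have hd : ContDiff ℝ ∞ (deriv h) := (contDiff_infty_iff_deriv.1 hh).2
  have hdiff : Differentiable ℝ h := hh.differentiable (by simp)
  have hd0 : ∀ t < δ, deriv h t = 0 := fun t ht => by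
    have : h =ᶠ[nhds t] fun _ => h 0 := Filter.eventually_of_mem (Iio_mem_nhds ht) hconst
    rw [this.deriv_eq, deriv_const]
  have hdz : ∀ t, ρ ^ 2 < t → deriv h t = 0 := fun t ht => by
    have : h =ᶠ[nhds t] fun _ => 0 := Filter.eventually_of_mem (Ioi_mem_nhds ht) hzero
    rw [this.deriv_eq, deriv_const]
  have hdn : ∀ t, deriv h t ≤ 0 := fun t => hanti.deriv_nonpos
  have hsq : ∀ x : EuclideanSpace ℝ (Fin n), ρ < ‖x‖ → ρ ^ 2 < ‖x‖ ^ 2 := fun x hx =>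
    pow_lt_pow_left₀ hx hρ0 two_ne_zero
  -- The division by `t ^ (m - 1)` is harmless: `deriv h` vanishes for `t < δ`, so the quotient is
  -- zero near the origin.
  have hK : ContDiff ℝ ∞ fun t => -2 * deriv h t / t ^ (m - 1) := by
    rw [contDiff_iff_contDiffAt]
    intro t
    rcases lt_or_ge t δ with ht | ht
    · refine (contDiffAt_const (c := (0 : ℝ))).congr_of_eventuallyEq
        (Filter.eventually_of_mem (Iio_mem_nhds ht) fun s hs => ?_)
      simp [hd0 s hs]
    · exact (contDiff_const.mul hd).contDiffAt.div (contDiff_id.pow _).contDiffAt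
        (pow_ne_zero _ (hδ.trans_le ht).ne')
  let u : 𝓓(U, ℝ) := radial h hh ρ hρ fun x hx => hzero _ (hsq x hx)
  let ψ : 𝓓(U, ℝ) := radial (fun t => 2 * deriv h t) (contDiff_const.mul hd) ρ hρ
    fun x hx => by simp [hdz _ (hsq x hx)]
  let w : 𝓓(U, ℝ) := radial (fun t => -2 * deriv h t * t) ((contDiff_const.mul hd).mul contDiff_id)
    ρ hρ fun x hx => by simp [hdz _ (hsq x hx)]
  let f : 𝓓(U, ℝ) := radial (fun t => -2 * deriv h t / t ^ (m - 1)) hK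
    ρ hρ fun x hx => by simp [hdz _ (hsq x hx)]
  have hcoord : ContDiff ℝ ∞ fun x : EuclideanSpace ℝ (Fin n) => x.ofLp :=
    (EuclideanSpace.equiv (Fin n) ℝ).contDiff
  have hcoord' : ∀ i, ContDiff ℝ ∞ fun x : EuclideanSpace ℝ (Fin n) => x.ofLp i :=
    fun i => contDiff_pi.1 hcoord i
  let A : Fin n × Fin n → EuclideanSpace ℝ (Fin n) → Fin n → ℝ := fun p x =>
    x.ofLp p.1 • Pi.single p.2 (1 : ℝ) - x.ofLp p.2 • Pi.single p.1 1
  have hA : ∀ p, ContDiff ℝ ∞ (A p) := fun p =>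
    ((hcoord' p.1).smul contDiff_const).sub ((hcoord' p.2).smul contDiff_const)
  let a₂ : TestForm U := smulSmooth w (fun _ => beta n ^ m) contDiff_const
  let a₃ : TestForm U := smulSmooth ψ (fun x => beta n ^ (m - 1) * wedgeSharp x.ofLp)
    (contDiff_mul contDiff_const (contDiff_wedgeSharp hcoord))
  let a₄ : TestForm U := smulSmooth u (fun _ => beta n ^ m) contDiff_const
  have hm1 : m - 1 + 1 = m := by omega
  -- Positivity for the m-th power of the Lagrange sum with coefficient `f`. The factor 2^m is the
  -- m-th power of the 2 in Lagrange's identity.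
  have h₁ : 0 ≤ T ((2 : ℝ) ^ m • (a₂ + (m : ℝ) • a₃)) := by
    refine hT.isPositive.nonneg_of_eq_smul_sum_pow hm f (fun x => ?_) A hA _ fun x => ?_
    · have := hdn (‖x‖ ^ 2)
      exact div_nonneg (by linarith) (by positivity)
    · have hN : ∑ i, x.ofLp i ^ 2 = ‖x‖ ^ 2 := (EuclideanSpace.real_norm_sq_eq x).symm
      have hcancel : f x * (‖x‖ ^ 2) ^ (m - 1) = -2 * deriv h (‖x‖ ^ 2) := by
        rcases eq_or_ne (‖x‖ ^ 2) 0 with h0 | h0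
        · have : deriv h 0 = 0 := hd0 0 hδ
          simp only [f, radial_apply, h0, this]
          simp
        · simp only [f, radial_apply]
          exact div_mul_cancel₀ _ (pow_ne_zero _ h0)
      have hpow := smul_beta_sub_wedgeSharp_pow x.ofLp (‖x‖ ^ 2) (m - 1)
      rw [hm1, show ((m - 1 : ℕ) : ℝ) + 1 = m by exact_mod_cast hm1] at hpow
      simp only [A]
      rw [sum_wedgeSharp_lagrange, hN, smul_pow, hpow, smul_comm (f x), smul_smul (f x), hcancel]
      change (2 : ℝ) ^ m • ((-2 * deriv h (‖x‖ ^ 2) * ‖x‖ ^ 2) • beta n ^ m +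
        (m : ℝ) • ((2 * deriv h (‖x‖ ^ 2)) • (beta n ^ (m - 1) * wedgeSharp x.ofLp))) = _
      module
  -- First variation with `ψ` = 2h'(|x|²). It trades `a₃`, which μ does not compute, for `a₄`, which
  -- it does.
  have h₂ : T (a₄ + a₃) = 0 := by
    refine hT.radial_identity u ψ (fun x => ?_) _ fun x => ?_
    · have h1 := (hdiff (‖x‖ ^ 2)).hasDerivAt.comp_hasFDerivAt x (hasStrictFDerivAt_norm_sq x).hasFDerivAt
      refine h1.congr_fderiv ?_
      ext y
      simp [ψ]
      ring
    · rw [hm1]; rfl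
  have h₃ := hμ.apply_eq w a₂ fun x => rfl
  have h₄ := hμ.apply_eq u a₄ fun x => rfl
  rw [map_smul, smul_eq_mul] at h₁
  have h₅ := nonneg_of_mul_nonneg_right h₁ (by positivity : (0 : ℝ) < 2 ^ m)
  rw [map_add, map_smul, smul_eq_mul] at h₅
  rw [map_add] at h₂
  rw [eq_neg_of_add_eq_zero_right h₂, h₃, h₄] at h₅
  have hfac : (0 : ℝ) < (m ! : ℝ) := by positivity
  have h₆ : (m ! : ℝ) * ((m : ℝ) * ∫ x, u x ∂μ) ≤ (m ! : ℝ) * ∫ x, w x ∂μ := by linarith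
  exact le_of_mul_le_mul_left h₆ hfac

end Supercurrent

/-- A smooth nonincreasing function which is `1` up to `a` and `0` from `b` on. -/
theorem exists_smooth_antitone_step {a b : ℝ} (hab : a < b) :
    ∃ χ : ℝ → ℝ, ContDiff ℝ ∞ χ ∧ Antitone χ ∧ (∀ t ≤ a, χ t = 1) ∧ ∀ t, b ≤ t → χ t = 0 := by
  have hba : 0 < b - a := sub_pos.2 hab
  refine ⟨fun t => Real.smoothTransition ((b - t) / (b - a)),
    Real.smoothTransition.contDiff.comp ((contDiff_const.sub contDiff_id).div_const _),
    fun s t hst => Real.smoothTransition.monotone (by gcongr), fun t ht => ?_, fun t ht => ?_⟩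
  · exact Real.smoothTransition.one_of_one_le ((one_le_div hba).2 (by linarith))
  · exact Real.smoothTransition.zero_of_nonpos (div_nonpos_of_nonpos_of_nonneg (by linarith) hba.le)

/-! ### From smoothed mass to balls -/

namespace Supercurrent

open SuperAlg TestFunction

variable {n m : ℕ} {U : Opens (EuclideanSpace ℝ (Fin n))} {T : Supercurrent U}

theorem integrable_of_norm_le_const {μ : Measure (EuclideanSpace ℝ (Fin n))}
    {g : EuclideanSpace ℝ (Fin n) → ℝ} {ρ C : ℝ}
    (hμ : μ (Metric.closedBall 0 ρ) < ⊤) (hg : Continuous g) (hC : ∀ x, |g x| ≤ C)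
    (h0 : ∀ x, ρ < ‖x‖ → g x = 0) : Integrable g μ := by
  have hs : Function.support g ⊆ Metric.closedBall 0 ρ := fun x hx => by
    contrapose! hx
    simpa using h0 x (by simpa using hx)
  rw [← integrableOn_iff_integrable_of_support_subset hs]
  exact IntegrableOn.of_bound hμ hg.aestronglyMeasurable C (Filter.Eventually.of_forall hC)

/-- The radial inequality for h(t) = χ(t/r²) reads m F ≤ r F', which is the sign of the derivative
of F/r^m. The parameter `κ` is the relative radius of the support: only the ball of radius `κ * R`
has to lie in `U`, so `R` itself may be larger than the balls in `U`. -/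
theorem IsMinimal.monotoneOn_smoothed_mass (hT : T.IsMinimal m) (hm : 1 ≤ m)
    {μ : Measure (EuclideanSpace ℝ (Fin n))} (hμ : T.IsMassMeasure m μ) {χ : ℝ → ℝ}
    (hχ : ContDiff ℝ ∞ χ) (hanti : Antitone χ) {κ δ R : ℝ} (hκ : 0 ≤ κ) (hδ : 0 < δ)
    (hconst : ∀ t < δ, χ t = χ 0) (hzero : ∀ t, κ ^ 2 < t → χ t = 0)
    (hR : Metric.closedBall (0 : EuclideanSpace ℝ (Fin n)) (κ * R) ⊆ U) :
    MonotoneOn (fun r : ℝ => (∫ x, χ (‖x‖ ^ 2 / r ^ 2) ∂μ) / r ^ m) (Set.Ioo 0 R) := by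
  have hfin : μ (Metric.closedBall 0 (κ * R)) < ⊤ := hμ.1 _ (isCompact_closedBall _ _) hR
  have hχd : ContDiff ℝ ∞ (deriv χ) := (contDiff_infty_iff_deriv.1 hχ).2
  have hdiff : Differentiable ℝ χ := hχ.differentiable (by simp)
  have hdz : ∀ t, κ ^ 2 < t → deriv χ t = 0 := fun t ht => by
    have : χ =ᶠ[nhds t] fun _ => 0 := Filter.eventually_of_mem (Ioi_mem_nhds ht) hzero
    rw [this.deriv_eq, deriv_const]
  have hd0 : ∀ t < δ, deriv χ t = 0 := fun t ht => by
    have : χ =ᶠ[nhds t] fun _ => χ 0 := Filter.eventually_of_mem (Iio_mem_nhds ht) hconst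
    rw [this.deriv_eq, deriv_const]
  obtain ⟨C, hC⟩ : ∃ C, ∀ t, |deriv χ t * t| ≤ C := by
    refine (hχd.continuous.mul continuous_id).bounded_above_of_compact_support
      (HasCompactSupport.intro (isCompact_Icc (a := δ) (b := κ ^ 2)) fun t ht => ?_)
    rw [Set.mem_Icc, not_and_or, not_le, not_le] at ht
    rcases ht with ht | ht
    · simp [hd0 t ht]
    · simp [hdz t ht]
  have hfar : ∀ r ∈ Set.Ioo 0 R, ∀ x : EuclideanSpace ℝ (Fin n), κ * R < ‖x‖ →
      κ ^ 2 < ‖x‖ ^ 2 / r ^ 2 := by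
    rintro r ⟨hr0, hrR⟩ x hx
    rw [lt_div_iff₀ (by positivity), ← mul_pow]
    exact pow_lt_pow_left₀ ((mul_le_mul_of_nonneg_left hrR.le hκ).trans_lt hx) (by positivity)
      two_ne_zero
  have hχ0 : ∀ t, 0 ≤ χ t := fun t => by
    rw [← hzero (max t (κ ^ 2 + 1)) (lt_max_of_lt_right (by linarith))]
    exact hanti (le_max_left _ _)
  let F : ℝ → EuclideanSpace ℝ (Fin n) → ℝ := fun r x => χ (‖x‖ ^ 2 / r ^ 2)
  let F' : ℝ → EuclideanSpace ℝ (Fin n) → ℝ := fun r x =>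
    deriv χ (‖x‖ ^ 2 / r ^ 2) * (-2 * ‖x‖ ^ 2 / r ^ 3)
  have hFc : ∀ r, Continuous (F r) := fun r =>
    hχ.continuous.comp ((continuous_norm.pow 2).div_const _)
  have hF'c : ∀ r, Continuous (F' r) := fun r =>
    (hχd.continuous.comp ((continuous_norm.pow 2).div_const _)).mul
      ((continuous_const.mul (continuous_norm.pow 2)).div_const _)
  have hFint : ∀ r ∈ Set.Ioo 0 R, Integrable (F r) μ := fun r hr =>
    integrable_of_norm_le_const hfin (hFc r) (C := χ 0)
      (fun x => by rw [abs_of_nonneg (hχ0 _)]; exact hanti (by positivity))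
      (fun x hx => hzero _ (hfar r hr x hx))
  have hder : ∀ r ∈ Set.Ioo 0 R,
      HasDerivAt (fun r => ∫ x, F r x ∂μ) (∫ x, F' r x ∂μ) r := by
    intro r hr
    -- Staying above r/2 gives 2/s ≤ 4/r, so one constant on a ball of finite mass dominates all the
    -- derivatives.
    refine (hasDerivAt_integral_of_dominated_loc_of_deriv_le (s := Set.Ioo (r / 2) R)
      (bound := (Metric.closedBall 0 (κ * R)).indicator fun _ => 4 * C / r)
      (Ioo_mem_nhds (by linarith [hr.1]) hr.2)
      (Filter.Eventually.of_forall fun r => (hFc r).aestronglyMeasurable) (hFint r hr)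
      (hF'c r).aestronglyMeasurable (Filter.Eventually.of_forall fun x s hs => ?_) ?_
      (Filter.Eventually.of_forall fun x s hs => ?_)).2
    · have hs0 : 0 < s := by linarith [hs.1, hr.1]
      by_cases hx : ‖x‖ ≤ κ * R
      · rw [Set.indicator_of_mem (by simpa using hx)]
        have h1 : F' s x = -(2 / s) * (deriv χ (‖x‖ ^ 2 / s ^ 2) * (‖x‖ ^ 2 / s ^ 2)) := by
          simp only [F']
          field_simp
        have hC0 : 0 ≤ C := (abs_nonneg _).trans (hC 0)
        have h2 : 2 / s ≤ 4 / r := by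
          rw [div_le_div_iff₀ hs0 hr.1]
          linarith [hs.1]
        rw [h1, Real.norm_eq_abs, abs_mul, abs_neg, abs_of_pos (by positivity : 0 < 2 / s)]
        calc 2 / s * _ ≤ 4 / r * C := mul_le_mul h2 (hC _) (abs_nonneg _) (by
              have := hr.1; positivity)
          _ = 4 * C / r := by ring
      · rw [Set.indicator_of_notMem (by simpa using hx)]
        simp [F', hdz _ (hfar s ⟨hs0, hs.2⟩ x (not_le.1 hx))]
    · exact (integrableOn_const hfin.ne).integrable_indicator Metric.isClosed_closedBall.measurableSet
    · have hs0 : s ≠ 0 := by linarith [hs.1, hr.1] |> ne_of_gt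
      have h1 : HasDerivAt (fun s : ℝ => ‖x‖ ^ 2 / s ^ 2) (-2 * ‖x‖ ^ 2 / s ^ 3) s := by
        refine ((hasDerivAt_const s (‖x‖ ^ 2)).div (hasDerivAt_pow 2 s)
          (pow_ne_zero 2 hs0)).congr_deriv ?_
        field_simp
        ring
      exact (hdiff _).hasDerivAt.comp s h1
  have hineq : ∀ r ∈ Set.Ioo 0 R, (m : ℝ) * ∫ x, F r x ∂μ ≤ r * ∫ x, F' r x ∂μ := by
    intro r hr
    have hr0 : 0 < r := hr.1
    have hr2 : 0 < r ^ 2 := by positivity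
    have h := hT.radial_inequality hm hμ (h := fun t => χ (t / r ^ 2))
      (hχ.comp (contDiff_id.div_const _)) (fun s t hst => hanti (by gcongr))
      (ρ := κ * R) (δ := δ * r ^ 2) (mul_nonneg hκ (hr.1.trans hr.2).le) (by positivity)
      (fun t ht => by rw [hconst _ ((div_lt_iff₀ hr2).2 ht), zero_div])
      (fun t ht => hzero _ (by
        rw [lt_div_iff₀ hr2, ← mul_pow]
        exact lt_of_le_of_lt (by have := hr.2; gcongr) ht)) hR
    refine h.trans_eq ?_
    rw [← integral_const_mul]
    refine integral_congr_ae (Filter.Eventually.of_forall fun x => ?_)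
    have h1 : deriv (fun t => χ (t / r ^ 2)) (‖x‖ ^ 2) = deriv χ (‖x‖ ^ 2 / r ^ 2) * (1 / r ^ 2) :=
      ((hdiff _).hasDerivAt.comp _ ((hasDerivAt_id _).div_const _)).deriv
    simp only [h1, F']
    field_simp
  have hquot : ∀ r ∈ Set.Ioo 0 R, HasDerivAt (fun r => (∫ x, F r x ∂μ) / r ^ m) _ r :=
    fun r hr => (hder r hr).div (hasDerivAt_pow m r) (pow_ne_zero m hr.1.ne')
  refine monotoneOn_of_deriv_nonneg (convex_Ioo 0 R)
    (fun r hr => (hquot r hr).continuousAt.continuousWithinAt)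
    (fun r hr => (hquot r (interior_subset hr)).differentiableAt.differentiableWithinAt)
    fun r hr => ?_
  replace hr := interior_subset hr
  have hr0 : 0 < r := hr.1
  rw [(hquot r hr).deriv]
  refine div_nonneg ?_ (by positivity)
  have h1 : (∫ x, F' r x ∂μ) * r ^ m - (∫ x, F r x ∂μ) * (m * r ^ (m - 1)) =
      r ^ (m - 1) * (r * (∫ x, F' r x ∂μ) - m * ∫ x, F r x ∂μ) := by
    rw [show r ^ m = r ^ (m - 1) * r by rw [← pow_succ]; congr 1; omega]
    ring
  rw [h1]
  exact mul_nonneg (by positivity) (sub_nonneg.2 (hineq r hr))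

/-- With χ equal to 1 up to q^6 and 0 from q^4 on, χ(|x|²/s²) is at least the indicator of the
closed ball of radius q³s, and χ(|x|²/r²) at most that of radius q²r. The gap from q²r to r keeps
all integrals finite even if the closed ball of radius r leaves `U`. -/
theorem IsMinimal.closedBall_le (hT : T.IsMinimal m) (hm : 1 ≤ m)
    {μ : Measure (EuclideanSpace ℝ (Fin n))} (hμ : T.IsMassMeasure m μ) {s r q : ℝ} (hs : 0 < s)
    (hsr : s ≤ r) (hr : Metric.ball (0 : EuclideanSpace ℝ (Fin n)) r ⊆ U) (hq0 : 0 < q)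
    (hq1 : q < 1) :
    μ (Metric.closedBall 0 (q ^ 3 * s)) / ENNReal.ofReal (s ^ m) ≤
      μ (Metric.ball 0 r) / ENNReal.ofReal (r ^ m) := by
  have hr0 : 0 < r := hs.trans_le hsr
  have hsub : ∀ t < r, Metric.closedBall (0 : EuclideanSpace ℝ (Fin n)) t ⊆ U := fun t ht =>
    (Metric.closedBall_subset_ball ht).trans hr
  have hfin : ∀ t < r, μ (Metric.closedBall 0 t) < ⊤ := fun t ht =>
    hμ.1 _ (isCompact_closedBall _ _) (hsub t ht)
  obtain ⟨χ, hχ, hanti, hone, hzero⟩ := exists_smooth_antitone_step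
    (pow_lt_pow_right_of_lt_one₀ hq0 hq1 (by norm_num : 4 < 6))
  have hq6 : 0 < q ^ 6 := by positivity
  have hqr : q ^ 2 * (r / q) = q * r := by field_simp
  have hqlt : q * r < r := mul_lt_of_lt_one_left hr0 hq1
  -- `R = r / q` makes the interval (0, R) contain `r`, while κR = qr < r keeps the supports in `U`.
  have hmono := hT.monotoneOn_smoothed_mass hm hμ hχ hanti (κ := q ^ 2) (R := r / q)
    (by positivity) hq6 (fun t ht => by rw [hone t ht.le, hone 0 hq6.le])
    (fun t ht => hzero t (by rw [← pow_mul] at ht; exact ht.le)) (by rw [hqr]; exact hsub _ hqlt)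
  have hrq : r < r / q := (lt_div_iff₀ hq0).2 (by rwa [mul_comm])
  have hle := hmono ⟨hs, hsr.trans_lt hrq⟩ ⟨hr0, hrq⟩ hsr
  have hχ0 : ∀ t, 0 ≤ χ t := fun t => by
    rw [← hzero (max t (q ^ 4)) (le_max_right _ _)]
    exact hanti (le_max_left _ _)
  have hχ1 : ∀ t, 0 ≤ t → χ t ≤ 1 := fun t ht => by
    rw [← hone 0 hq6.le]
    exact hanti ht
  have hfar : ∀ t, 0 < t → ∀ x : EuclideanSpace ℝ (Fin n), q ^ 2 * t < ‖x‖ →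
      χ (‖x‖ ^ 2 / t ^ 2) = 0 := fun t ht x hx => by
    refine hzero _ ?_
    rw [le_div_iff₀ (by positivity), show q ^ 4 * t ^ 2 = (q ^ 2 * t) ^ 2 by ring]
    gcongr
  have hqq : q ^ 2 < 1 := pow_lt_one₀ hq0.le hq1 two_ne_zero
  have hlt : ∀ t, 0 < t → t ≤ r → q ^ 2 * t < r := fun t ht htr =>
    (mul_lt_of_lt_one_left ht hqq).trans_le htr
  have hint : ∀ t, 0 < t → t ≤ r → Integrable (fun x => χ (‖x‖ ^ 2 / t ^ 2)) μ :=
    fun t ht htr => integrable_of_norm_le_const (hfin _ (hlt t ht htr))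
      (hχ.continuous.comp ((continuous_norm.pow 2).div_const _)) (C := 1)
      (fun x => by rw [abs_of_nonneg (hχ0 _)]; exact hχ1 _ (by positivity)) (hfar t ht)
  have hlow : μ.real (Metric.closedBall 0 (q ^ 3 * s)) ≤ ∫ x, χ (‖x‖ ^ 2 / s ^ 2) ∂μ := by
    have hq3 : q ^ 3 * s < r :=
      (mul_lt_of_lt_one_left hs (pow_lt_one₀ hq0.le hq1 (by norm_num))).trans_le hsr
    rw [← integral_indicator_one Metric.isClosed_closedBall.measurableSet]
    refine integral_mono ((integrableOn_const (hfin _ hq3).ne).integrable_indicator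
      Metric.isClosed_closedBall.measurableSet) (hint s hs hsr) fun x => ?_
    by_cases hx : ‖x‖ ≤ q ^ 3 * s
    · rw [Set.indicator_of_mem (by simpa using hx), hone _ ((div_le_iff₀ (by positivity)).2 ?_)]
      · rfl
      · rw [show q ^ 6 * s ^ 2 = (q ^ 3 * s) ^ 2 by ring]
        gcongr
    · rw [Set.indicator_of_notMem (by simpa using hx)]
      exact hχ0 _
  have hup : ∫ x, χ (‖x‖ ^ 2 / r ^ 2) ∂μ ≤ μ.real (Metric.closedBall 0 (q ^ 2 * r)) := by
    rw [← integral_indicator_one Metric.isClosed_closedBall.measurableSet]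
    refine integral_mono (hint r hr0 le_rfl) ((integrableOn_const
      (hfin _ (hlt r hr0 le_rfl)).ne).integrable_indicator
      Metric.isClosed_closedBall.measurableSet) fun x => ?_
    by_cases hx : ‖x‖ ≤ q ^ 2 * r
    · rw [Set.indicator_of_mem (by simpa using hx)]
      exact hχ1 _ (by positivity)
    · rw [Set.indicator_of_notMem (by simpa using hx), hfar r hr0 x (not_le.1 hx)]
  have hreal : μ.real (Metric.closedBall 0 (q ^ 3 * s)) / s ^ m ≤
      μ.real (Metric.closedBall 0 (q ^ 2 * r)) / r ^ m := by
    refine le_trans ?_ (hle.trans ?_)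
    · exact div_le_div_of_nonneg_right hlow (by positivity)
    · exact div_le_div_of_nonneg_right hup (by positivity)
  have hconv : ∀ ρ t : ℝ, 0 < t → ρ < r → μ (Metric.closedBall 0 ρ) / ENNReal.ofReal (t ^ m) =
      ENNReal.ofReal (μ.real (Metric.closedBall 0 ρ) / t ^ m) := fun ρ t ht hρ => by
    rw [ENNReal.ofReal_div_of_pos (by positivity), ofReal_measureReal (hfin ρ hρ).ne]
  calc μ (Metric.closedBall 0 (q ^ 3 * s)) / ENNReal.ofReal (s ^ m)
      ≤ μ (Metric.closedBall 0 (q ^ 2 * r)) / ENNReal.ofReal (r ^ m) := by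
        rw [hconv _ s hs ((mul_lt_of_lt_one_left hs
          (pow_lt_one₀ hq0.le hq1 (by norm_num))).trans_le hsr), hconv _ r hr0 (hlt r hr0 le_rfl)]
        exact ENNReal.ofReal_le_ofReal hreal
    _ ≤ μ (Metric.ball 0 r) / ENNReal.ofReal (r ^ m) := by
        gcongr
        exact Metric.closedBall_subset_ball (hlt r hr0 le_rfl)

end Supercurrent

theorem theorem6p2 (n m : ℕ) (hm : 1 ≤ m) (U : Opens (EuclideanSpace ℝ (Fin n)))
    (h0 : (0 : EuclideanSpace ℝ (Fin n)) ∈ U) (T : Supercurrent U) (hT : T.IsMinimal m) :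
    (∃ μ : Measure (EuclideanSpace ℝ (Fin n)), T.IsMassMeasure m μ) ∧
    ∀ μ : Measure (EuclideanSpace ℝ (Fin n)), T.IsMassMeasure m μ →
      MonotoneOn (fun r : ℝ => μ (Metric.ball 0 r) / ENNReal.ofReal (r ^ m))
        {r : ℝ | 0 < r ∧ Metric.ball (0 : EuclideanSpace ℝ (Fin n)) r ⊆ U} := by
  refine ⟨hT.exists_isMassMeasure hm, fun μ hμ s ⟨hs, _⟩ r ⟨hr0, hr⟩ hsr => ?_⟩
  -- The shift by 2 makes `q 0` = 1/2 positive. As `q k` increases to 1, the closed balls of radius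
  -- q³s exhaust the open ball, and continuity of μ from below concludes, infinite values included.
  let q : ℕ → ℝ := fun k => 1 - 1 / ((k : ℝ) + 2)
  have hq1 : ∀ k, q k < 1 := fun k => sub_lt_self _ (by positivity)
  have hq0 : ∀ k, 0 < q k := fun k =>
    sub_pos.2 ((div_lt_one (by positivity)).2 (by linarith [(Nat.cast_nonneg k : (0 : ℝ) ≤ k)]))
  have hqmono : Monotone q := fun j k hjk => by
    have : (j : ℝ) ≤ k := by exact_mod_cast hjk
    simp only [q]
    gcongr
  have hqlim : Filter.Tendsto (fun k => q k ^ 3 * s) Filter.atTop (nhds s) := by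
    have h1 : Filter.Tendsto (fun k : ℕ => 1 / ((k : ℝ) + 2)) Filter.atTop (nhds 0) :=
      tendsto_const_nhds.div_atTop
        (Filter.tendsto_atTop_add_const_right _ _ tendsto_natCast_atTop_atTop)
    simpa [q] using ((h1.const_sub 1).pow 3).mul_const s
  have hunion : Metric.ball (0 : EuclideanSpace ℝ (Fin n)) s =
      ⋃ k, Metric.closedBall 0 (q k ^ 3 * s) := by
    ext x
    simp only [Set.mem_iUnion, mem_ball_zero_iff, mem_closedBall_zero_iff]
    constructor
    · intro hx
      exact ((hqlim.eventually (lt_mem_nhds hx)).exists).imp fun k hk => hk.le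
    · rintro ⟨k, hk⟩
      exact hk.trans_lt (mul_lt_of_lt_one_left hs (pow_lt_one₀ (hq0 k).le (hq1 k) (by norm_num)))
  have hmono : Monotone fun k => Metric.closedBall (0 : EuclideanSpace ℝ (Fin n)) (q k ^ 3 * s) :=
    fun j k hjk => Metric.closedBall_subset_closedBall (by
      have := hqmono hjk
      have := (hq0 j).le
      gcongr)
  change μ (Metric.ball 0 s) / _ ≤ _
  rw [hunion, hmono.measure_iUnion, ENNReal.iSup_div]
  exact iSup_le fun k => hT.closedBall_le hm hμ hs hsr hr (hq0 k) (hq1 k)
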